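/- Let $G$ be a finite group, let $\mathcal H\neq 0$ be a finite-dimensional complex Hilbert space, and let $\{U(f)\}_{f\in G}$ be a unitary projective representation of $G$ on $\mathcal H$ with factor system $\mu$, i.e. a family of unitary operators on $\mathcal H$ with $U(f)U(g)=\mu(f,g)\,U(fg)$ for all $f,g\in G$, where $\mu(f,g)\in\mathbb C$. Let $\lambda$ range over the equivalence classes of irreducible unitary projective representations $D^{(\lambda)}$ of $G$ with the same factor system $\mu$, and let $d_\lambda$ be the dimension of $D^{(\lambda)}$; there are finitely many such classes. Then the number of linearly independent operators in the collection $\{U(f)\}_{f\in G}$, i.e. the dimension of the linear space of operators that they span, is $$\dim_{\mathbb C}\operatorname{span}\{U(f): f\in G\}=\sum_{\lambda\text{ contained in }U} d_\lambda^2,$$ where $\lambda$ is contained in $U$ if the restriction of $U$ to some invariant subspace of $\mathcal H$ is equivalent to $D^{(\lambda)}$ (that is, $D^{(\lambda)}$ occurs in $U$ with multiplicity at least $1$). In particular, the family $\{U(f)\}_{f\in G}$ is linearly independent if and only if every class $\lambda$ of irreducible unitary projective representations with factor system $\mu$ is contained in $U$. -/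

import Mathlib

/-- A unitary projective representation of `G` on `V` with factor system `μ`: unitary operators
`U f` on `V` with `U f * U g = μ f g • U (f * g)`.  When `V` is nonzero, this relation forces `μ`
to be of modulus one and to satisfy the cocycle identity; and when moreover `μ 1 1 = 1`, it forces
`U 1` to be the identity. -/
structure UnitaryProjRep {G : Type*} [Group G] (μ : G → G → ℂ)
    (V : Type*) [NormedAddCommGroup V] [InnerProductSpace ℂ V] where
  /-- the unitary operator representing a group element -/
  U : G → (V ≃ₗᵢ[ℂ] V)
  U_mul : ∀ (f g : G) (v : V), U f (U g v) = μ f g • U (f * g) v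

namespace UnitaryProjRep

variable {G : Type*} [Group G] {μ : G → G → ℂ}
  {V : Type*} [NormedAddCommGroup V] [InnerProductSpace ℂ V]
  {W : Type*} [NormedAddCommGroup W] [InnerProductSpace ℂ W]

/-- The operator `U f`, as an element of the complex vector space of linear operators on `V`. -/
def operator (R : UnitaryProjRep μ V) (f : G) : V →ₗ[ℂ] V :=
  (R.U f).toLinearEquiv.toLinearMap

/-- Irreducibility: `V` is nonzero and has no invariant subspace besides `0` and `V`. -/
def IsIrreducible (R : UnitaryProjRep μ V) : Prop :=
  Nontrivial V ∧ ∀ S : Submodule ℂ V, (∀ f : G, ∀ v ∈ S, R.U f v ∈ S) → S = ⊥ ∨ S = ⊤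

/-- Equivalence of two representations with the same factor system. -/
def Equivalent (R : UnitaryProjRep μ V) (R' : UnitaryProjRep μ W) : Prop :=
  ∃ T : V ≃ₗ[ℂ] W, ∀ (f : G) (v : V), T (R.U f v) = R'.U f (T v)

/-- `R` contains `D`: some invariant subspace of `R` (the range of `T`) carries a
representation equivalent to `D`. -/
def Contains (R : UnitaryProjRep μ V) (D : UnitaryProjRep μ W) : Prop :=
  ∃ T : W →ₗ[ℂ] V, Function.Injective T ∧ ∀ (f : G) (w : W), T (D.U f w) = R.U f (T w)

theorem Contains.congr {W' : Type*} [NormedAddCommGroup W'] [InnerProductSpace ℂ W']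
    {R : UnitaryProjRep μ V} {D : UnitaryProjRep μ W} {D' : UnitaryProjRep μ W'}
    (h : R.Contains D) (e : D'.Equivalent D) : R.Contains D' := by
  obtain ⟨T, hT, hc⟩ := h
  obtain ⟨E, hE⟩ := e
  refine ⟨T ∘ₗ E.toLinearMap, hT.comp E.injective, fun f w => ?_⟩
  simp [hE, hc]

theorem Equivalent.refl (R : UnitaryProjRep μ V) : R.Equivalent R :=
  ⟨LinearEquiv.refl ℂ V, fun _ _ => rfl⟩

theorem Equivalent.symm {R : UnitaryProjRep μ V} {R' : UnitaryProjRep μ W}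
    (h : R.Equivalent R') : R'.Equivalent R := by
  obtain ⟨T, hT⟩ := h
  exact ⟨T.symm, fun f w => T.injective (by simp [hT])⟩

theorem Equivalent.trans {X : Type*} [NormedAddCommGroup X] [InnerProductSpace ℂ X]
    {R : UnitaryProjRep μ V} {R' : UnitaryProjRep μ W} {R'' : UnitaryProjRep μ X}
    (h : R.Equivalent R') (h' : R'.Equivalent R'') : R.Equivalent R'' := by
  obtain ⟨T, hT⟩ := h
  obtain ⟨T', hT'⟩ := h'
  exact ⟨T.trans T', fun f v => by simp [hT, hT']⟩

end UnitaryProjRep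

/-- An irreducible unitary projective representation with factor system `μ` by `dim × dim`
unitary matrices, that is, on the Hilbert space `ℂ ^ dim`. -/
structure ProjIrrep {G : Type*} [Group G] (μ : G → G → ℂ) where
  dim : ℕ
  rep : UnitaryProjRep μ (EuclideanSpace ℂ (Fin dim))
  irreducible : rep.IsIrreducible

/-- Equivalence of irreducible representations with factor system `μ`. -/
instance ProjIrrep.setoid {G : Type*} [Group G] (μ : G → G → ℂ) : Setoid (ProjIrrep μ) where
  r D D' := D.rep.Equivalent D'.rep
  iseqv := ⟨fun D => .refl D.rep, fun h => h.symm, fun h h' => h.trans h'⟩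

/-- The set of equivalence classes `lam` of irreducible unitary projective representations of `G`
with factor system `μ`. -/
def ProjIrrepClass {G : Type*} [Group G] (μ : G → G → ℂ) : Type _ :=
  Quotient (ProjIrrep.setoid μ)

/-- The dimension `d_lam` of a class of irreducible representations. -/
def ProjIrrepClass.dim {G : Type*} [Group G] {μ : G → G → ℂ} : ProjIrrepClass μ → ℕ :=
  Quotient.lift ProjIrrep.dim fun D D' h => by
    obtain ⟨T, _⟩ := h
    simpa using T.finrank_eq

/-- The irreducible representations of the class `lam` are contained in `R`. -/
def UnitaryProjRep.ContainsClass {G : Type*} [Group G] {μ : G → G → ℂ}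
    {V : Type*} [NormedAddCommGroup V] [InnerProductSpace ℂ V]
    (R : UnitaryProjRep μ V) : ProjIrrepClass μ → Prop :=
  Quotient.lift (fun D => R.Contains D.rep) fun _ _ h =>
    propext ⟨fun c => c.congr (UnitaryProjRep.Equivalent.symm h), fun c => c.congr h⟩

/-! The functions `f ↦ ⟪U f v, x⟫` span a subspace of `ℂ^G` whose orthogonal complement consists of
the linear relations among the `U f` (`orthogonal_coeffSpace`), so by rank-nullity it has the
dimension of the span of the operators. By complete reducibility it is spanned by the coefficients
of the irreducibles contained in `U` (`coeffSpace_eq_span`). Schur orthogonality makes these, over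
all classes, an orthogonal family of nonzero vectors (`linearIndependent_coeffFamily`), with `d ^ 2`
members per class. Independence of the operators means that the coefficients fill `ℂ^G`; those of
the twisted regular representation do, so having every class suffices. -/

open scoped InnerProductSpace

namespace UnitaryProjRep

/-! ### Complete reducibility and Schur's lemma -/

section Basic

variable {G : Type*} [Group G] {μ : G → G → ℂ}
  {V : Type*} [NormedAddCommGroup V] [InnerProductSpace ℂ V]
  {W : Type*} [NormedAddCommGroup W] [InnerProductSpace ℂ W]

theorem Equivalent.contains {R : UnitaryProjRep μ V} {D : UnitaryProjRep μ W}
    (h : D.Equivalent R) : R.Contains D := by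
  obtain ⟨T, hT⟩ := h
  exact ⟨T.toLinearMap, T.injective, hT⟩

/-- The factor system of a nonzero unitary projective representation has modulus one. -/
theorem norm_factor [Nontrivial V] (R : UnitaryProjRep μ V) (f g : G) : ‖μ f g‖ = 1 := by
  obtain ⟨v, hv⟩ := exists_ne (0 : V)
  have h := congrArg norm (R.U_mul f g v)
  rw [norm_smul, LinearIsometryEquiv.norm_map, LinearIsometryEquiv.norm_map,
    LinearIsometryEquiv.norm_map] at h
  exact (mul_eq_right₀ (norm_ne_zero_iff.2 hv)).1 h.symm

/-- The factor system of a nonzero unitary projective representation is a cocycle. -/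
theorem factor_cocycle [Nontrivial V] (R : UnitaryProjRep μ V) (f g h : G) :
    μ f (g * h) * μ g h = μ f g * μ (f * g) h := by
  obtain ⟨v, hv⟩ := exists_ne (0 : V)
  have h₁ : R.U f (R.U g (R.U h v)) = (μ f (g * h) * μ g h) • R.U (f * g * h) v := by
    rw [R.U_mul g h, map_smul, R.U_mul, smul_smul, mul_assoc f, mul_comm]
  have h₂ : R.U f (R.U g (R.U h v)) = (μ f g * μ (f * g) h) • R.U (f * g * h) v := by
    rw [R.U_mul f g, R.U_mul, smul_smul]
  have hne : R.U (f * g * h) v ≠ 0 := by simpa using hv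
  exact smul_left_injective ℂ hne (h₁.symm.trans h₂)

/-- A submodule stable under all the operators of the representation. -/
def IsInvariant (R : UnitaryProjRep μ V) (S : Submodule ℂ V) : Prop :=
  ∀ f : G, ∀ v ∈ S, R.U f v ∈ S

/-- A dimension count replaces the inverse of `U f`, which is `U f⁻¹` only up to a scalar. -/
theorem IsInvariant.map_eq [FiniteDimensional ℂ V] {R : UnitaryProjRep μ V} {S : Submodule ℂ V}
    (hS : R.IsInvariant S) (f : G) : S.map (R.operator f) = S := by
  refine Submodule.eq_of_le_of_finrank_eq ?_ ?_
  · rintro _ ⟨v, hv, rfl⟩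
    exact hS f v hv
  · exact LinearEquiv.finrank_map_eq (R.U f).toLinearEquiv S

theorem IsInvariant.orthogonal [FiniteDimensional ℂ V] {R : UnitaryProjRep μ V}
    {S : Submodule ℂ V} (hS : R.IsInvariant S) : R.IsInvariant Sᗮ := by
  intro f v hv s hs
  rw [← hS.map_eq f] at hs
  obtain ⟨s, hs, rfl⟩ := hs
  exact ((R.U f).inner_map_map s v).trans (hv s hs)

/-- An invariant subspace carries a representation on some `ℂ ^ n`. -/
theorem IsInvariant.exists_restrict [FiniteDimensional ℂ V] {R : UnitaryProjRep μ V}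
    {S : Submodule ℂ V} (hS : R.IsInvariant S) :
    ∃ (n : ℕ) (D : UnitaryProjRep μ (EuclideanSpace ℂ (Fin n)))
      (T : EuclideanSpace ℂ (Fin n) →ₗ[ℂ] V), Function.Injective T ∧ LinearMap.range T = S ∧
        ∀ f w, T (D.U f w) = R.U f (T w) := by
  let e := (stdOrthonormalBasis ℂ S).repr
  let r : G → (S ≃ₗᵢ[ℂ] S) := fun f =>
    LinearIsometry.toLinearIsometryEquiv
      (⟨(R.operator f).restrict (hS f), fun v => (R.U f).norm_map v⟩ : S →ₗᵢ[ℂ] S) rfl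
  have hr : ∀ f (v : S), (r f v : V) = R.U f v := fun f v => rfl
  refine ⟨_, ⟨fun f => (e.symm.trans (r f)).trans e, fun f g v => ?_⟩,
    S.subtype ∘ₗ e.symm.toLinearEquiv.toLinearMap, ?_, ?_, fun f w => ?_⟩
  · apply e.symm.injective
    apply Subtype.ext
    simp [hr, R.U_mul]
  · exact Subtype.val_injective.comp e.symm.injective
  · rw [LinearMap.range_comp, LinearEquiv.range, Submodule.map_top, Submodule.range_subtype]
  · simp [hr]

/-- Every nonzero invariant subspace contains a minimal one. -/
theorem IsInvariant.exists_minimal [FiniteDimensional ℂ V] {R : UnitaryProjRep μ V}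
    {S : Submodule ℂ V} (hS : R.IsInvariant S) (hne : S ≠ ⊥) :
    ∃ M ≤ S, R.IsInvariant M ∧ M ≠ ⊥ ∧ ∀ N ≤ M, R.IsInvariant N → N = ⊥ ∨ N = M := by
  obtain ⟨M, ⟨hMS, hM, hM0⟩, hmin⟩ := (wellFounded_lt (α := Submodule ℂ V)).has_min
    {M | M ≤ S ∧ R.IsInvariant M ∧ M ≠ ⊥} ⟨S, le_rfl, hS, hne⟩
  refine ⟨M, hMS, hM, hM0, fun N hNM hN => ?_⟩
  by_contra! h
  exact hmin N ⟨hNM.trans hMS, hN, h.1⟩ (lt_of_le_of_ne hNM h.2)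

/-- A minimal invariant subspace carries an irreducible representation. -/
theorem IsInvariant.exists_irrep [FiniteDimensional ℂ V] {R : UnitaryProjRep μ V}
    {M : Submodule ℂ V} (hM : R.IsInvariant M) (hne : M ≠ ⊥)
    (hmin : ∀ N ≤ M, R.IsInvariant N → N = ⊥ ∨ N = M) :
    ∃ (D : ProjIrrep μ) (T : EuclideanSpace ℂ (Fin D.dim) →ₗ[ℂ] V),
      Function.Injective T ∧ LinearMap.range T = M ∧
        ∀ f w, T (D.rep.U f w) = R.U f (T w) := by
  obtain ⟨n, D, T, hT, hTM, hc⟩ := hM.exists_restrict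
  refine ⟨⟨n, D, ?_, fun N hN => ?_⟩, T, hT, hTM, hc⟩
  · by_contra h
    rw [not_nontrivial_iff_subsingleton] at h
    apply hne
    rw [← hTM, LinearMap.range_eq_bot]
    exact Subsingleton.elim _ _
  · have hN' : R.IsInvariant (N.map T) := by
      rintro f _ ⟨w, hw, rfl⟩
      exact ⟨D.U f w, hN f w hw, hc f w⟩
    refine (hmin (N.map T) (hTM ▸ LinearMap.map_le_range) hN').imp (fun h => ?_) fun h => ?_
    · exact Submodule.map_injective_of_injective hT (h.trans (Submodule.map_bot T).symm)
    · refine Submodule.map_injective_of_injective hT ?_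
      rw [h, Submodule.map_top, hTM]

/-- Complete reducibility: a submodule containing the image of every irreducible subrepresentation
is everything. -/
theorem eq_top_of_irrep_le [FiniteDimensional ℂ V] (R : UnitaryProjRep μ V) (S : Submodule ℂ V)
    (hS : ∀ (D : ProjIrrep μ) (T : EuclideanSpace ℂ (Fin D.dim) →ₗ[ℂ] V),
      Function.Injective T → (∀ f w, T (D.rep.U f w) = R.U f (T w)) → LinearMap.range T ≤ S) :
    S = ⊤ := by
  -- `S` need not be invariant, so the largest invariant subspace inside it is used.
  let A : Set (Submodule ℂ V) := {M | R.IsInvariant M ∧ M ≤ S}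
  have hA : R.IsInvariant (sSup A) := by
    intro f
    change sSup A ≤ (sSup A).comap (R.operator f)
    exact sSup_le fun M hM v hv => le_sSup hM (hM.1 f v hv)
  have hbot : (sSup A)ᗮ = ⊥ := by
    by_contra hne
    obtain ⟨M, hMA, hM, hM0, hmin⟩ := hA.orthogonal.exists_minimal hne
    obtain ⟨D, T, hT, hTM, hc⟩ := hM.exists_irrep hM0 hmin
    have hle : M ≤ sSup A := le_sSup ⟨hM, hTM ▸ hS D T hT hc⟩
    exact hM0 (disjoint_self.1 ((Submodule.orthogonal_disjoint (sSup A)).mono hle hMA))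
  rw [Submodule.orthogonal_eq_bot_iff] at hbot
  exact top_le_iff.1 (hbot ▸ sSup_le fun M hM => hM.2)

/-- Schur's lemma for two irreducible representations. -/
theorem IsIrreducible.eq_zero_or_equivalent {D : UnitaryProjRep μ V} {D' : UnitaryProjRep μ W}
    (hD : D.IsIrreducible) (hD' : D'.IsIrreducible) (T : V →ₗ[ℂ] W)
    (hT : ∀ f v, T (D.U f v) = D'.U f (T v)) : T = 0 ∨ D.Equivalent D' := by
  rcases hD.2 (LinearMap.ker T) (fun f v hv => by
    rw [LinearMap.mem_ker] at hv ⊢; rw [hT, hv, map_zero]) with hk | hk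
  · rcases hD'.2 (LinearMap.range T) (by
      rintro f _ ⟨v, rfl⟩; exact ⟨D.U f v, hT f v⟩) with hr | hr
    · exact .inl (LinearMap.range_eq_bot.1 hr)
    · exact .inr ⟨LinearEquiv.ofBijective T
        ⟨LinearMap.ker_eq_bot.1 hk, LinearMap.range_eq_top.1 hr⟩, hT⟩
  · exact .inl (LinearMap.ker_eq_top.1 hk)

/-- Schur's lemma for one irreducible representation. -/
theorem IsIrreducible.exists_eq_smul [FiniteDimensional ℂ V] {D : UnitaryProjRep μ V}
    (hD : D.IsIrreducible) (T : V →ₗ[ℂ] V) (hT : ∀ f v, T (D.U f v) = D.U f (T v)) :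
    ∃ c : ℂ, ∀ v, T v = c • v := by
  have := hD.1
  obtain ⟨c, hc⟩ := Module.End.exists_eigenvalue T
  refine ⟨c, fun v => ?_⟩
  rcases hD.2 (Module.End.eigenspace T c) (fun f v hv => by
    rw [Module.End.mem_eigenspace_iff] at hv ⊢; rw [hT, hv, map_smul]) with h | h
  · exact absurd h hc
  · exact Module.End.mem_eigenspace_iff.1 (h ▸ Submodule.mem_top)

end Basic

/-! ### Matrix coefficients and orthogonality relations -/

section Coeff

variable {G : Type*} [Group G] {μ : G → G → ℂ}
  {V : Type*} [NormedAddCommGroup V] [InnerProductSpace ℂ V]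
  {W : Type*} [NormedAddCommGroup W] [InnerProductSpace ℂ W]

/-- The (conjugate) matrix coefficient `f ↦ ⟪U f v, x⟫`, sesquilinear in `v` and `x`. -/
noncomputable def coeff (R : UnitaryProjRep μ V) : V →ₗ⋆[ℂ] V →ₗ[ℂ] EuclideanSpace ℂ G :=
  LinearMap.mk₂'ₛₗ (starRingEnd ℂ) (RingHom.id ℂ)
    (fun v x => WithLp.toLp 2 fun f => ⟪R.U f v, x⟫_ℂ)
    (fun v w x => by ext f; simp)
    (fun c v x => by ext f; simp [mul_comm])
    (fun v x y => by ext f; simp)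
    (fun c v x => by ext f; simp)

@[simp]
theorem coeff_apply (R : UnitaryProjRep μ V) (v x : V) (f : G) :
    R.coeff v x f = ⟪R.U f v, x⟫_ℂ := rfl

/-- The space of matrix coefficients. -/
noncomputable def coeffSpace (R : UnitaryProjRep μ V) : Submodule ℂ (EuclideanSpace ℂ G) :=
  Submodule.span ℂ (Set.range fun p : V × V => R.coeff p.1 p.2)

theorem coeff_mem_coeffSpace (R : UnitaryProjRep μ V) (v x : V) : R.coeff v x ∈ R.coeffSpace :=
  Submodule.subset_span ⟨(v, x), rfl⟩

theorem coeffSpace_le_iff {R : UnitaryProjRep μ V} {K : Submodule ℂ (EuclideanSpace ℂ G)} :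
    R.coeffSpace ≤ K ↔ ∀ v x, R.coeff v x ∈ K := by
  rw [coeffSpace, Submodule.span_le, Set.range_subset_iff, Prod.forall]
  rfl

/-- `T` need not be isometric; a left inverse `L` gives `⟪D f v, x⟫ = ⟪L (T (D f v)), x⟫ = ⟪U f (T
v), L* x⟫`. -/
theorem Contains.coeffSpace_le [FiniteDimensional ℂ V] [FiniteDimensional ℂ W]
    {R : UnitaryProjRep μ V} {D : UnitaryProjRep μ W} (h : R.Contains D) :
    D.coeffSpace ≤ R.coeffSpace := by
  obtain ⟨T, hT, hc⟩ := h
  obtain ⟨L, hL⟩ := T.exists_leftInverse_of_injective (LinearMap.ker_eq_bot.2 hT)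
  rw [coeffSpace_le_iff]
  intro v x
  convert R.coeff_mem_coeffSpace (T v) (LinearMap.adjoint L x) using 1
  ext f
  rw [coeff_apply, coeff_apply, LinearMap.adjoint_inner_right, ← hc]
  exact congrArg (⟪·, x⟫_ℂ) (LinearMap.congr_fun hL (D.U f v)).symm

theorem coeffSpace_eq_span_basis {ι : Type*} [Fintype ι] (R : UnitaryProjRep μ V)
    (b : Module.Basis ι ℂ V) :
    R.coeffSpace = Submodule.span ℂ (Set.range fun p : ι × ι => R.coeff (b p.1) (b p.2)) := by
  apply le_antisymm
  · rw [coeffSpace_le_iff]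
    intro v x
    rw [← b.sum_repr v, ← b.sum_repr x, map_sum R.coeff, LinearMap.sum_apply]
    refine Submodule.sum_mem _ fun i _ => ?_
    rw [map_sum]
    refine Submodule.sum_mem _ fun j _ => ?_
    rw [map_smul, LinearMap.map_smulₛₗ, LinearMap.smul_apply]
    exact Submodule.smul_mem _ _ (Submodule.smul_mem _ _ (Submodule.subset_span ⟨(i, j), rfl⟩))
  · rw [Submodule.span_le, Set.range_subset_iff]
    exact fun p => R.coeff_mem_coeffSpace _ _

/-- The coefficients of a representation are generated by those of the irreducible
representations that it contains. -/
theorem coeffSpace_le_of_irrep [FiniteDimensional ℂ V] (R : UnitaryProjRep μ V)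
    (K : Submodule ℂ (EuclideanSpace ℂ G))
    (hK : ∀ D : ProjIrrep μ, R.Contains D.rep → D.rep.coeffSpace ≤ K) : R.coeffSpace ≤ K := by
  let S : Submodule ℂ V :=
    { carrier := {v | ∀ x, R.coeff v x ∈ K}
      add_mem' := fun hv hw x => by
        rw [map_add, LinearMap.add_apply]; exact K.add_mem (hv x) (hw x)
      zero_mem' := fun x => by rw [map_zero, LinearMap.zero_apply]; exact K.zero_mem
      smul_mem' := fun c v hv x => by
        rw [LinearMap.map_smulₛₗ, LinearMap.smul_apply]; exact K.smul_mem _ (hv x) }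
  have hS : S = ⊤ := by
    refine R.eq_top_of_irrep_le S fun D T hT hc => ?_
    rintro _ ⟨w, rfl⟩ x
    refine hK D ⟨T, hT, hc⟩ ?_
    convert D.rep.coeff_mem_coeffSpace w (LinearMap.adjoint T x) using 1
    ext f
    rw [coeff_apply, coeff_apply, LinearMap.adjoint_inner_right, hc]
  rw [coeffSpace_le_iff]
  intro v
  have hv : v ∈ S := hS ▸ Submodule.mem_top
  exact hv

variable [Fintype G]

/-- Linear combinations of the operators of a representation. -/
noncomputable def operatorSum (R : UnitaryProjRep μ V) :
    EuclideanSpace ℂ G →ₗ[ℂ] (V →ₗ[ℂ] V) :=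
  Fintype.linearCombination ℂ R.operator ∘ₗ (WithLp.linearEquiv 2 ℂ (G → ℂ)).toLinearMap

theorem operatorSum_apply (R : UnitaryProjRep μ V) (c : EuclideanSpace ℂ G) (v : V) :
    R.operatorSum c v = ∑ f, c f • R.U f v := by
  simp [operatorSum, Fintype.linearCombination_apply, operator]

theorem range_operatorSum (R : UnitaryProjRep μ V) :
    LinearMap.range R.operatorSum = Submodule.span ℂ (Set.range R.operator) := by
  rw [operatorSum, LinearMap.range_comp, LinearEquiv.range, Submodule.map_top,
    Fintype.range_linearCombination]

theorem inner_coeff (R : UnitaryProjRep μ V) (v x : V) (c : EuclideanSpace ℂ G) :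
    ⟪R.coeff v x, c⟫_ℂ = ⟪x, R.operatorSum c v⟫_ℂ := by
  simp [operatorSum_apply, PiLp.inner_apply]

/-- By `inner_coeff`, pairing `c` with the coefficients yields exactly the matrix elements of `∑ f,
c f • U f`. -/
theorem orthogonal_coeffSpace (R : UnitaryProjRep μ V) :
    R.coeffSpaceᗮ = LinearMap.ker R.operatorSum := by
  ext c
  rw [LinearMap.mem_ker, ← Submodule.span_singleton_le_iff_mem, Submodule.le_orthogonal_iff_le_orthogonal,
    coeffSpace_le_iff]
  simp only [Submodule.mem_orthogonal_singleton_iff_inner_left, inner_coeff]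
  constructor
  · exact fun h => LinearMap.ext fun v => ext_inner_left ℂ fun x => by simpa using h v x
  · intro h v x
    simp [h]

theorem finrank_span_operator (R : UnitaryProjRep μ V) :
    Module.finrank ℂ (Submodule.span ℂ (Set.range R.operator)) =
      Module.finrank ℂ R.coeffSpace := by
  have h₁ := R.coeffSpace.finrank_add_finrank_orthogonal
  have h₂ := R.operatorSum.finrank_range_add_finrank_ker
  rw [orthogonal_coeffSpace] at h₁
  rw [range_operatorSum] at h₂
  omega

theorem linearIndependent_operator_iff (R : UnitaryProjRep μ V) :
    LinearIndependent ℂ R.operator ↔ R.coeffSpace = ⊤ := by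
  rw [← Submodule.orthogonal_eq_bot_iff, orthogonal_coeffSpace,
    linearIndependent_iff_injective_fintypeLinearCombination, LinearMap.ker_eq_bot, operatorSum, LinearMap.coe_comp,
    LinearEquiv.coe_coe, EquivLike.injective_comp]

/-- The average over the group of the operators `y ↦ ⟪D' f u, y⟫ • D f v`. -/
noncomputable def average (D : UnitaryProjRep μ V) (D' : UnitaryProjRep μ W) (v : V) (u : W) :
    W →ₗ[ℂ] V :=
  ∑ f, ((innerSL ℂ (D'.U f u)).toLinearMap.smulRight (D.U f v))

theorem average_apply (D : UnitaryProjRep μ V) (D' : UnitaryProjRep μ W) (v : V) (u y : W) :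
    D.average D' v u y = ∑ f, ⟪D'.U f u, y⟫_ℂ • D.U f v := by
  simp [average]

/-- Substituting `g * f` for `f` produces `μ g f` from `D` and its conjugate from `D'`; their
product is 1. -/
theorem average_map (D : UnitaryProjRep μ V) (D' : UnitaryProjRep μ W) (v : V) (u : W) (g : G)
    (y : W) : D.average D' v u (D'.U g y) = D.U g (D.average D' v u y) := by
  rcases subsingleton_or_nontrivial V with hV | hV
  · exact Subsingleton.elim _ _
  rw [average_apply, average_apply, map_sum, ← Equiv.sum_comp (Equiv.mulLeft g)]
  refine Finset.sum_congr rfl fun f _ => ?_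
  rw [Equiv.coe_mulLeft, map_smul, D.U_mul, smul_smul, ← (D'.U g).inner_map_map (D'.U f u) y,
    D'.U_mul, inner_smul_left, mul_right_comm, ← Complex.normSq_eq_conj_mul_self,
    Complex.normSq_eq_norm_sq, D.norm_factor]
  simp

theorem inner_coeff_coeff (D : UnitaryProjRep μ V) (D' : UnitaryProjRep μ W) (v x : V)
    (u y : W) : ⟪D.coeff v x, D'.coeff u y⟫_ℂ = ⟪x, D.average D' v u y⟫_ℂ := by
  rw [inner_coeff, operatorSum_apply, average_apply]
  rfl

theorem IsIrreducible.inner_coeff_eq_zero {D : UnitaryProjRep μ V} {D' : UnitaryProjRep μ W}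
    (hD : D.IsIrreducible) (hD' : D'.IsIrreducible) (h : ¬ D'.Equivalent D) (v x : V) (u y : W) :
    ⟪D.coeff v x, D'.coeff u y⟫_ℂ = 0 := by
  rw [inner_coeff_coeff, (hD'.eq_zero_or_equivalent hD _ (D.average_map D' v u)).resolve_right h,
    LinearMap.zero_apply, inner_zero_right]

/-- Schur's orthogonality relations. -/
theorem IsIrreducible.finrank_mul_inner_coeff [FiniteDimensional ℂ V] {D : UnitaryProjRep μ V}
    (hD : D.IsIrreducible) (v x u y : V) :
    (Module.finrank ℂ V : ℂ) * ⟪D.coeff v x, D.coeff u y⟫_ℂ =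
      Fintype.card G * ⟪u, v⟫_ℂ * ⟪x, y⟫_ℂ := by
  obtain ⟨c, hc⟩ := hD.exists_eq_smul _ (D.average_map D v u)
  have key : ∀ x y, ⟪D.coeff v x, D.coeff u y⟫_ℂ = c * ⟪x, y⟫_ℂ := fun x y => by
    rw [inner_coeff_coeff, hc, inner_smul_right]
  -- The trace determines the Schur scalar: by Parseval and unitarity each `f` contributes `⟪u, v⟫`.
  have htr : c * Module.finrank ℂ V = Fintype.card G * ⟪u, v⟫_ℂ := by
    let b := stdOrthonormalBasis ℂ V
    calc c * Module.finrank ℂ V = ∑ i, ⟪D.coeff v (b i), D.coeff u (b i)⟫_ℂ := by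
          simp [key, mul_comm]
      _ = ∑ f, ∑ i, ⟪D.U f u, b i⟫_ℂ * ⟪b i, D.U f v⟫_ℂ := by
          rw [Finset.sum_comm]
          refine Finset.sum_congr rfl fun i _ => ?_
          simp [PiLp.inner_apply]
      _ = Fintype.card G * ⟪u, v⟫_ℂ := by
          simp [b.sum_inner_mul_inner]
  rw [key, ← mul_assoc, mul_comm _ c, htr]

end Coeff

/-! ### The twisted regular representation -/

section Regular

variable {G : Type*} [Group G] [Fintype G] {μ : G → G → ℂ}

/-- The regular representation twisted by a unitary cocycle. -/
noncomputable def regular (hμ : ∀ f g, ‖μ f g‖ = 1)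
    (hc : ∀ f g h, μ f (g * h) * μ g h = μ f g * μ (f * g) h) :
    UnitaryProjRep μ (EuclideanSpace ℂ G) where
  U f := LinearIsometry.toLinearIsometryEquiv
    { toFun := fun φ => WithLp.toLp 2 fun g => μ f (f⁻¹ * g) * φ (f⁻¹ * g)
      map_add' := fun φ ψ => by ext g; simp [mul_add]
      map_smul' := fun c φ => by ext g; simp [mul_left_comm]
      norm_map' := fun φ => by
        simp only [LinearMap.coe_mk, AddHom.coe_mk, EuclideanSpace.norm_eq, norm_mul, hμ, one_mul]
        congr 1
        exact Equiv.sum_comp (Equiv.mulLeft f⁻¹) fun g => ‖φ g‖ ^ 2 } rfl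
  U_mul f g φ := by
    ext h
    have h₁ : f⁻¹ * h = g * ((f * g)⁻¹ * h) := by group
    have h₂ : g⁻¹ * (f⁻¹ * h) = (f * g)⁻¹ * h := by group
    change μ f (f⁻¹ * h) * (μ g (g⁻¹ * (f⁻¹ * h)) * φ (g⁻¹ * (f⁻¹ * h))) =
      μ f g * (μ (f * g) ((f * g)⁻¹ * h) * φ ((f * g)⁻¹ * h))
    rw [h₂, h₁, ← mul_assoc, hc, mul_assoc]

theorem coeffSpace_regular (hμ : ∀ f g, ‖μ f g‖ = 1)
    (hc : ∀ f g h, μ f (g * h) * μ g h = μ f g * μ (f * g) h) :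
    (regular hμ hc).coeffSpace = ⊤ := by
  classical
  refine eq_top_iff.2 fun c _ => ?_
  -- As `U f` sends `δ_1` to `μ f 1 • δ_f`, the factor `μ f 1` in the second vector cancels the
  -- conjugate phase and leaves `c f`.
  convert (regular hμ hc).coeff_mem_coeffSpace (EuclideanSpace.single 1 1)
    (WithLp.toLp 2 fun f => μ f 1 * c f) using 1
  ext f
  have hU : ∀ g, (regular hμ hc).U f (EuclideanSpace.single 1 1) g =
      if g = f then μ f 1 else 0 := fun g => by
    change μ f (f⁻¹ * g) * (EuclideanSpace.single (1 : G) (1 : ℂ)) (f⁻¹ * g) = _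
    by_cases h : g = f
    · simp [h]
    · have : f⁻¹ * g ≠ 1 := fun h' => h (inv_mul_eq_one.1 h').symm
      simp [h, this]
  rw [coeff_apply, PiLp.inner_apply, Finset.sum_eq_single f]
  · simp only [hU, if_true, RCLike.inner_apply]
    rw [mul_right_comm, Complex.mul_conj, Complex.normSq_eq_norm_sq, hμ]
    simp
  · intro g _ hg
    simp [hU, hg]
  · simp

end Regular

end UnitaryProjRep

/-! ### Classes of irreducibles and the dimension count -/

namespace ProjIrrepClass

open UnitaryProjRep

variable {G : Type*} [Group G] {μ : G → G → ℂ}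

/-- A representative of a class of irreducible representations. -/
noncomputable def out (lam : ProjIrrepClass μ) : ProjIrrep μ := Quotient.out lam

theorem dim_out (lam : ProjIrrepClass μ) : lam.out.dim = lam.dim :=
  congrArg ProjIrrepClass.dim (Quotient.out_eq lam)

theorem containsClass_iff {V : Type*} [NormedAddCommGroup V] [InnerProductSpace ℂ V]
    (R : UnitaryProjRep μ V) (lam : ProjIrrepClass μ) :
    R.ContainsClass lam ↔ R.Contains lam.out.rep :=
  iff_of_eq (congrArg R.ContainsClass (Quotient.out_eq lam)).symm

theorem dim_out_pos (lam : ProjIrrepClass μ) : 0 < lam.out.dim := by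
  have := lam.out.irreducible.1
  simpa using Module.finrank_pos (R := ℂ) (M := EuclideanSpace ℂ (Fin lam.out.dim))

/-- The matrix coefficients of the irreducible representations in the standard basis. -/
noncomputable def coeffFamily
    (s : Σ lam : ProjIrrepClass μ, Fin lam.out.dim × Fin lam.out.dim) : EuclideanSpace ℂ G :=
  s.1.out.rep.coeff (EuclideanSpace.basisFun _ ℂ s.2.1) (EuclideanSpace.basisFun _ ℂ s.2.2)

theorem span_coeffFamily (lam : ProjIrrepClass μ) :
    Submodule.span ℂ (Set.range fun p => coeffFamily ⟨lam, p⟩) = lam.out.rep.coeffSpace := by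
  rw [lam.out.rep.coeffSpace_eq_span_basis (EuclideanSpace.basisFun _ ℂ).toBasis]
  simp [coeffFamily]

variable {V : Type*} [NormedAddCommGroup V] [InnerProductSpace ℂ V] [FiniteDimensional ℂ V]

theorem coeffSpace_eq_span (R : UnitaryProjRep μ V) :
    R.coeffSpace = Submodule.span ℂ (coeffFamily '' {s | R.ContainsClass s.1}) := by
  apply le_antisymm
  · refine R.coeffSpace_le_of_irrep _ fun D hD => ?_
    let lam : ProjIrrepClass μ := Quotient.mk _ D
    have he : D.rep.Equivalent lam.out.rep :=
      Setoid.symm (Quotient.mk_out (s := ProjIrrep.setoid μ) D)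
    refine he.contains.coeffSpace_le.trans ?_
    rw [← span_coeffFamily]
    refine Submodule.span_mono ?_
    rintro _ ⟨p, rfl⟩
    exact ⟨⟨lam, p⟩, hD, rfl⟩
  · rw [Submodule.span_le]
    rintro _ ⟨⟨lam, p⟩, hs, rfl⟩
    exact ((containsClass_iff R lam).1 hs).coeffSpace_le (lam.out.rep.coeff_mem_coeffSpace _ _)

variable [Fintype G]

theorem linearIndependent_coeffFamily :
    LinearIndependent ℂ (coeffFamily (μ := μ)) := by
  apply linearIndependent_of_ne_zero_of_inner_eq_zero
  · rintro ⟨lam, i, j⟩ h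
    have key := lam.out.irreducible.finrank_mul_inner_coeff (EuclideanSpace.basisFun _ ℂ i)
      (EuclideanSpace.basisFun _ ℂ j) (EuclideanSpace.basisFun _ ℂ i)
      (EuclideanSpace.basisFun _ ℂ j)
    rw [show lam.out.rep.coeff _ _ = 0 from h] at key
    -- With equal unit vectors on both sides, `key` reads `d * 0 = |G|`.
    refine Fintype.card_ne_zero (α := G) ?_
    simpa using key.symm
  · rintro ⟨lam, i, j⟩ ⟨kap, k, l⟩ hne
    by_cases hlk : kap = lam
    · subst hlk
      have key := kap.out.irreducible.finrank_mul_inner_coeff (EuclideanSpace.basisFun _ ℂ i)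
        (EuclideanSpace.basisFun _ ℂ j) (EuclideanSpace.basisFun _ ℂ k)
        (EuclideanSpace.basisFun _ ℂ l)
      have h0 : (kap.out.dim : ℂ) ≠ 0 := Nat.cast_ne_zero.2 kap.dim_out_pos.ne'
      rw [orthonormal_iff_ite.1 (EuclideanSpace.basisFun _ ℂ).orthonormal,
        orthonormal_iff_ite.1 (EuclideanSpace.basisFun _ ℂ).orthonormal,
        finrank_euclideanSpace_fin] at key
      refine (mul_eq_zero.1 (key.trans ?_)).resolve_left h0
      by_cases hki : k = i
      · have hjl : j ≠ l := fun h => hne (by rw [hki, h])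
        simp [hjl]
      · simp [hki]
    · refine lam.out.irreducible.inner_coeff_eq_zero kap.out.irreducible (fun h => hlk ?_) _ _ _ _
      exact (Quotient.out_equiv_out (s := ProjIrrep.setoid μ)).1 h

/-- Every class has the coefficient with index `(0, 0)`, and an independent family in `ℂ^G` is
finite. -/
theorem finite : Finite (ProjIrrepClass μ) := by
  have := (linearIndependent_coeffFamily (μ := μ)).finite
  exact Finite.of_injective (fun lam : ProjIrrepClass μ =>
    (⟨lam, ⟨0, lam.dim_out_pos⟩, ⟨0, lam.dim_out_pos⟩⟩ :
      Σ lam : ProjIrrepClass μ, Fin lam.out.dim × Fin lam.out.dim))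
    fun _ _ h => congrArg Sigma.fst h

theorem finrank_coeffSpace (R : UnitaryProjRep μ V) :
    Module.finrank ℂ R.coeffSpace =
      ∑ᶠ (lam : ProjIrrepClass μ) (_ : R.ContainsClass lam), lam.dim ^ 2 := by
  classical
  have := finite (μ := μ)
  have := Fintype.ofFinite (ProjIrrepClass μ)
  have hset : coeffFamily '' {s | R.ContainsClass s.1} = Set.range
      (fun s : {s : Σ lam : ProjIrrepClass μ, Fin lam.out.dim × Fin lam.out.dim //
        R.ContainsClass s.1} => coeffFamily s.1) := by
    rw [Set.image_eq_range]; rfl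
  have hli : LinearIndependent ℂ
      (fun s : {s : Σ lam : ProjIrrepClass μ, Fin lam.out.dim × Fin lam.out.dim //
        R.ContainsClass s.1} => coeffFamily s.1) :=
    linearIndependent_coeffFamily.comp _ Subtype.val_injective
  rw [coeffSpace_eq_span, hset, finrank_span_eq_card hli, Fintype.card_subtype,
    Finset.card_filter, Fintype.sum_sigma, finsum_eq_sum_of_fintype]
  refine Finset.sum_congr rfl fun lam _ => ?_
  rw [finsum_eq_if]
  by_cases h : R.ContainsClass lam <;> simp [h, dim_out, sq]

/-- A coefficient of a missing class would lie outside the span. Conversely, since `V` is nonzero,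
`μ` is a unitary cocycle, so the regular representation exists and all its classes occur in `R`. -/
theorem coeffSpace_eq_top_iff [Nontrivial V] (R : UnitaryProjRep μ V) :
    R.coeffSpace = ⊤ ↔ ∀ lam : ProjIrrepClass μ, R.ContainsClass lam := by
  constructor
  · intro h lam
    by_contra hlam
    let s : Σ lam : ProjIrrepClass μ, Fin lam.out.dim × Fin lam.out.dim :=
      ⟨lam, ⟨0, lam.dim_out_pos⟩, ⟨0, lam.dim_out_pos⟩⟩
    refine linearIndependent_coeffFamily.notMem_span_image
      (s := {s | R.ContainsClass s.1}) (x := s) hlam ?_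
    rw [← coeffSpace_eq_span, h]
    exact Submodule.mem_top
  · intro h
    rw [eq_top_iff, ← coeffSpace_regular R.norm_factor R.factor_cocycle, coeffSpace_eq_span,
      coeffSpace_eq_span R]
    exact Submodule.span_mono (Set.image_mono fun s _ => h s.1)

end ProjIrrepClass

theorem theorem4 {G : Type*} [Group G] [Finite G] {μ : G → G → ℂ}
    {H : Type*} [NormedAddCommGroup H] [InnerProductSpace ℂ H] [FiniteDimensional ℂ H]
    [Nontrivial H] (R : UnitaryProjRep μ H) :
    Finite (ProjIrrepClass μ) ∧
    Module.finrank ℂ (Submodule.span ℂ (Set.range R.operator)) =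
      ∑ᶠ (lam : ProjIrrepClass μ) (_ : R.ContainsClass lam), lam.dim ^ 2 ∧
    (LinearIndependent ℂ R.operator ↔ ∀ lam : ProjIrrepClass μ, R.ContainsClass lam) := by
  have := Fintype.ofFinite G
  exact ⟨ProjIrrepClass.finite,
    R.finrank_span_operator.trans (ProjIrrepClass.finrank_coeffSpace R),
    R.linearIndependent_operator_iff.trans (ProjIrrepClass.coeffSpace_eq_top_iff R)⟩
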